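/- **Theorem (failure of strong completeness for regular SCL-models).** Let $\mathbf{MALC}$ be the multiplicative-additive Lambek calculus without Lambek's non-emptiness restriction: formulae are built from countably many variables and the constants $\mathbf 1,\top,\bot$ by $\backslash,/,\cdot,\wedge,\vee$; sequents are $A_1,\dots,A_n\to B$ with $n\ge 0$; the rules are the usual left and right rules and axioms of the full Lambek calculus $\mathbf{FL}_\bot$, including Cut. Let $\mathbf{ACT}_\omega$ (infinitary action logic) be its extension by Kleene iteration $A^*$ with the $\omega$-rule "from $\Gamma,A^n,\Delta\to C$ for all $n\ge0$ infer $\Gamma,A^*,\Delta\to C$" and the rules "from $\Pi_i\to A$ ($1\le i\le n$) infer $\Pi_1,\dots,\Pi_n\to A^*$" ($n\ge0$). Derivations are well-founded, and derivability from a set $\mathcal H$ of sequents means derivability with the elements of $\mathcal H$ as additional axioms. For a language $L\subseteq\Sigma^*$ and $M\subseteq\Sigma^*$ let $$M^{\rhd\lhd}=\{v\in\Sigma^* \mid \forall x,y\in\Sigma^*\,\bigl((\forall w\in M\; xwy\in L)\Rightarrow xvy\in L\bigr)\},$$ and let $\mathcal B_L=\{M\subseteq \Sigma^*\mid M=M^{\rhd\lhd}\}$,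 ordered by inclusion, with operations $M\circ N=(M\cdot N)^{\rhd\lhd}$, $M\backslash N=\{u\mid\forall v\in M\; vu\in N\}$, $N/M=\{u\mid\forall v\in M\; uv\in N\}$, $M\cap N$, $(M\cup N)^{\rhd\lhd}$, $(M^*)^{\rhd\lhd}$, top $\Sigma^*$, zero $\varnothing^{\rhd\lhd}$ and unit $\{\varepsilon\}^{\rhd\lhd}$. An SCL-model interprets formulae in $\mathcal B_L$ by sending variables to arbitrary elements and the connectives and constants to these operations and constants. More generally, an SCL-model with non-standard $\bot$ does the same in an upper cone $\{M\in\mathcal B_L\mid Z\subseteq M\}$, with $\bot$ interpreted as $Z$, where $Z\in\mathcal B_L$ satisfies $Z\subseteq\{\varepsilon\}^{\rhd\lhd}$ and $M\circ Z=Z\circ M=Z$ for all $M\in\mathcal B_L$ with $M\supseteq Z$. The sequent $A_1,\dots,A_n\to B$ is true in a model if the $\circ$-product of the interpretations of $A_1,\dots,A_n$ (the unit, if $n=0$) is contained in the interpretation of $B$. A model is *regular* if $L$ is recognised by a finite-state automaton. (The alphabet $\Sigma$ may be infinite.) A logic is *strongly complete* with respect to a class of models if every sequent that is true in all models of the class in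 which all sequents of a set $\mathcal H$ are true is derivable from $\mathcal H$, for every set $\mathcal H$ of sequents. Then neither $\mathbf{ACT}_\omega$ nor even $\mathbf{MALC}$ is strongly complete with respect to regular SCL-models, whether with non-standard $\bot$ or with the standard interpretation of $\bot$. In all these cases strong completeness fails already for finite sets $\mathcal H$ of hypotheses. -/

import Mathlib

namespace SCL

/-- The two calculi: `malc` is the multiplicative-additive Lambek calculus without Lambek's
non-emptiness restriction (with unit, zero and top), and `actω` is its extension with Kleene
iteration governed by an omega-rule (infinitary action logic). -/
inductive Calculus : Type
  | malc
  | actω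

/-- Formulae of the calculus `c`, over the variables `p₀, p₁, p₂, …`.
Kleene iteration belongs to the language of `actω` only. -/
inductive Formula (c : Calculus) : Type
  | var (n : ℕ)
  | one
  | top
  | bot
  /-- `ldiv A B` is `A \ B`. -/
  | ldiv (A B : Formula c)
  /-- `rdiv B A` is `B / A`. -/
  | rdiv (B A : Formula c)
  | prod (A B : Formula c)
  | conj (A B : Formula c)
  | disj (A B : Formula c)
  | star (h : c = Calculus.actω) (A : Formula c)

/-- Sequents `A₁, …, Aₙ → B`, where `n = 0` is allowed. -/
structure Sequent (c : Calculus) : Type where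
  ante : List (Formula c)
  succ : Formula c

open Formula in
/-- `Derives H Γ C`: the sequent `Γ → C` is derivable in the calculus `c` from the set `H` of
hypotheses. Cut is a rule; the derivations of `actω` are well-founded and may be infinite. -/
inductive Derives {c : Calculus} (H : Set (Sequent c)) : List (Formula c) → Formula c → Prop
  | hyp {Γ C} : Sequent.mk Γ C ∈ H → Derives H Γ C
  | id (A) : Derives H [A] A
  | bot_left (Γ Δ C) : Derives H (Γ ++ [bot] ++ Δ) C
  | top_right (Γ) : Derives H Γ top
  | one_left {Γ Δ C} : Derives H (Γ ++ Δ) C → Derives H (Γ ++ [one] ++ Δ) C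
  | one_right : Derives H [] one
  | prod_left {Γ Δ A B C} :
      Derives H (Γ ++ [A, B] ++ Δ) C → Derives H (Γ ++ [prod A B] ++ Δ) C
  | prod_right {Γ Δ A B} : Derives H Γ A → Derives H Δ B → Derives H (Γ ++ Δ) (prod A B)
  | ldiv_left {Γ Δ P A B C} :
      Derives H P A → Derives H (Γ ++ [B] ++ Δ) C → Derives H (Γ ++ P ++ [ldiv A B] ++ Δ) C
  | ldiv_right {P A B} : Derives H ([A] ++ P) B → Derives H P (ldiv A B)
  | rdiv_left {Γ Δ P A B C} :
      Derives H P A → Derives H (Γ ++ [B] ++ Δ) C → Derives H (Γ ++ [rdiv B A] ++ P ++ Δ) C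
  | rdiv_right {P A B} : Derives H (P ++ [A]) B → Derives H P (rdiv B A)
  | conj_left₁ {Γ Δ A B C} :
      Derives H (Γ ++ [A] ++ Δ) C → Derives H (Γ ++ [conj A B] ++ Δ) C
  | conj_left₂ {Γ Δ A B C} :
      Derives H (Γ ++ [B] ++ Δ) C → Derives H (Γ ++ [conj A B] ++ Δ) C
  | conj_right {P A B} : Derives H P A → Derives H P B → Derives H P (conj A B)
  | disj_left {Γ Δ A B C} : Derives H (Γ ++ [A] ++ Δ) C → Derives H (Γ ++ [B] ++ Δ) C →
      Derives H (Γ ++ [disj A B] ++ Δ) C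
  | disj_right₁ {P A B} : Derives H P A → Derives H P (disj A B)
  | disj_right₂ {P A B} : Derives H P B → Derives H P (disj A B)
  | cut {Γ Δ P A C} : Derives H P A → Derives H (Γ ++ [A] ++ Δ) C → Derives H (Γ ++ P ++ Δ) C
  | star_left {h : c = Calculus.actω} {Γ Δ A C} :
      (∀ n : ℕ, Derives H (Γ ++ List.replicate n A ++ Δ) C) →
      Derives H (Γ ++ [star h A] ++ Δ) C
  | star_right {h : c = Calculus.actω} {A} (Ps : List (List (Formula c))) :
      (∀ P ∈ Ps, Derives H P A) → Derives H Ps.flatten (star h A)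

section Lattice

variable {α : Type*}

/-- The contexts that accept every word of `M`, with respect to `L`. -/
def contexts (L M : Language α) : Set (List α × List α) :=
  {k | ∀ w ∈ M, k.1 ++ w ++ k.2 ∈ L}

/-- The words (possibly empty) accepted by all contexts from `K`, with respect to `L`. -/
def words (L : Language α) (K : Set (List α × List α)) : Language α :=
  {v | ∀ k ∈ K, k.1 ++ v ++ k.2 ∈ L}

/-- The closure of the language `M` with respect to `L`. -/
def closure (L M : Language α) : Language α := words L (contexts L M)

/-- `M` is closed, i.e. an element of the syntactic concept lattice of `L`. -/
def IsClosed (L M : Language α) : Prop := M = closure L M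

/-- The product of the syntactic concept lattice of `L`. -/
def comp (L M N : Language α) : Language α := closure L (M * N)

/-- The unit of the syntactic concept lattice of `L`: the closure of `{ε}`. -/
def unit (L : Language α) : Language α := closure L 1

/-- The least element of the syntactic concept lattice of `L`: the closure of the empty language. -/
def zero (L : Language α) : Language α := closure L 0

/-- `ldiv M N` is `M \ N`. -/
def ldiv (M N : Language α) : Language α := {u | ∀ v ∈ M, v ++ u ∈ N}

/-- `rdiv N M` is `N / M`. -/
def rdiv (N M : Language α) : Language α := {u | ∀ v ∈ M, u ++ v ∈ N}

/-- `Z` is a local zero of the syntactic concept lattice of `L`. -/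
def IsLocalZero (L Z : Language α) : Prop :=
  IsClosed L Z ∧ ∀ M, IsClosed L M → Z ≤ M → comp L M Z = Z ∧ comp L Z M = Z

end Lattice

/-- An SCL-model with non-standard zero: an algebraic model on the upper cone of a local zero `Z`
in the syntactic concept lattice of a language `L`. The cone has to contain the unit. Variables
range over the cone, and `Z` interprets the zero constant. -/
structure Model where
  Alphabet : Type*
  L : Language Alphabet
  Z : Language Alphabet
  isLocalZero : IsLocalZero L Z
  le_unit : Z ≤ unit L
  val : ℕ → Language Alphabet
  isClosed_val : ∀ n, IsClosed L (val n)
  le_val : ∀ n, Z ≤ val n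

namespace Model

/-- The interpretation of formulae in a model. -/
def interp (𝔪 : Model) {c : Calculus} : Formula c → Language 𝔪.Alphabet
  | .var n => 𝔪.val n
  | .one => unit 𝔪.L
  | .top => ⊤
  | .bot => 𝔪.Z
  | .ldiv A B => ldiv (𝔪.interp A) (𝔪.interp B)
  | .rdiv B A => rdiv (𝔪.interp B) (𝔪.interp A)
  | .prod A B => comp 𝔪.L (𝔪.interp A) (𝔪.interp B)
  | .conj A B => 𝔪.interp A ⊓ 𝔪.interp B
  | .disj A B => closure 𝔪.L (𝔪.interp A ⊔ 𝔪.interp B)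
  | .star _ A => closure 𝔪.L (KStar.kstar (𝔪.interp A))

/-- A sequent `A₁, …, Aₙ → B` is true if the product of the interpretations of `A₁, …, Aₙ` (the
unit, if `n = 0`) is below the interpretation of `B`. -/
def IsTrue (𝔪 : Model) {c : Calculus} (s : Sequent c) : Prop :=
  (s.ante.map 𝔪.interp).foldr (comp 𝔪.L) (unit 𝔪.L) ≤ 𝔪.interp s.succ

end Model

/-- The regular SCL-models (with a possibly non-standard zero): `L` is a regular language. -/
def regularModels : Set Model := {𝔪 | 𝔪.L.IsRegular}

/-- The regular SCL-models with the standard zero: the model is on the whole syntactic concept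
lattice. -/
def standardRegularModels : Set Model := {𝔪 | 𝔪.L.IsRegular ∧ 𝔪.Z = zero 𝔪.L}

/-- Semantic entailment on a class `𝔐` of models. -/
def Entails (𝔐 : Set Model) {c : Calculus} (H : Set (Sequent c)) (s : Sequent c) : Prop :=
  ∀ 𝔪 ∈ 𝔐, (∀ t ∈ H, 𝔪.IsTrue t) → 𝔪.IsTrue s

/-- Strong completeness of the calculus `c` with respect to a class `𝔐` of models. -/
def StronglyComplete (c : Calculus) (𝔐 : Set Model) : Prop :=
  ∀ (H : Set (Sequent c)) (s : Sequent c), Entails 𝔐 H s → Derives H s.ante s.succ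

/-- Strong completeness restricted to finite sets of hypotheses. -/
def StronglyCompleteFinite (c : Calculus) (𝔐 : Set Model) : Prop :=
  ∀ (H : Set (Sequent c)) (s : Sequent c), H.Finite → Entails 𝔐 H s → Derives H s.ante s.succ

end SCL

universe u

/-! The counterexample separates finite monoids from the bicyclic monoid. The hypotheses make `p₀ ·
p₁` equivalent to the unit, and the sequent in question puts `p₁ · p₀` above the unit. The syntactic
concept lattice of a regular language is a finite monoid, where one-sided inverses are two-sided
(`comp_eq_unit_of_comp_eq_unit`), so the sequent is entailed. It is not derivable: both calculi are
sound for binary relations (`Derives.relInterpList_le`), and on ℕ the successor relation followed by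
its converse is the identity, while the opposite composite misses 0. The zero constant does not
occur in these sequents, so one finite set of hypotheses settles all the cases. -/

namespace SCL

/-! ### Finiteness and inverses in syntactic concept lattices -/

section Closure

variable {α : Type*} {L M N : Language α}

theorem le_closure : M ≤ closure L M := fun _ hw _ hk => hk _ hw

theorem isClosed_closure : IsClosed L (closure L M) :=
  le_antisymm le_closure fun _ hw k hk => hw k fun _ hv => hv k hk

theorem closure_le (hN : IsClosed L N) (h : M ≤ N) : closure L M ≤ N := by
  rw [hN]
  exact fun _ hw k hk => hw k fun _ hv => hk _ (h hv)

/-- A left factor `u ∈ M` can be absorbed into the context: if `(x, y)` accepts `M * N`, then `(xu,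
y)` accepts `N`, hence its closure. With the mirror image below, this makes `comp` associative. -/
theorem closure_mul_closure_right : closure L (M * closure L N) = closure L (M * N) := by
  refine le_antisymm (closure_le isClosed_closure ?_) (closure_le isClosed_closure ?_)
  · rintro _ ⟨u, hu, v, hv, rfl⟩ k hk
    simpa using hv (k.1 ++ u, k.2) fun w hw => by simpa using hk _ ⟨u, hu, w, hw, rfl⟩
  · exact (mul_le_mul_right le_closure M).trans le_closure

theorem closure_mul_closure_left : closure L (closure L M * N) = closure L (M * N) := by
  refine le_antisymm (closure_le isClosed_closure ?_) (closure_le isClosed_closure ?_)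
  · rintro _ ⟨u, hu, v, hv, rfl⟩ k hk
    simpa using hu (k.1, v ++ k.2) fun w hw => by simpa using hk _ ⟨w, hw, v, hv, rfl⟩
  · exact (mul_le_mul_left le_closure N).trans le_closure

theorem comp_assoc (L M N K : Language α) :
    comp L (comp L M N) K = comp L M (comp L N K) := by
  simp only [comp, closure_mul_closure_left, closure_mul_closure_right, mul_assoc]

theorem unit_comp (hM : IsClosed L M) : comp L (unit L) M = M := by
  rw [comp, unit, closure_mul_closure_left, one_mul, ← hM]

theorem comp_unit (hM : IsClosed L M) : comp L M (unit L) = M := by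
  rw [comp, unit, closure_mul_closure_right, mul_one, ← hM]

/-- Membership of `v` in a closed set depends only on the transformation of the states of an
automaton for `L` that is induced by `v`. -/
theorem mem_of_evalFrom_eq {σ : Type*} {A : DFA α σ} (hM : IsClosed A.accepts M) {v w : List α}
    (h : ∀ s, A.evalFrom s v = A.evalFrom s w) (hv : v ∈ M) : w ∈ M := by
  rw [hM] at hv ⊢
  intro k hk
  simpa [DFA.mem_accepts, DFA.eval, DFA.evalFrom_of_append, h] using hv k hk

/-- The syntactic concept lattice of a regular language is finite. -/
theorem finite_setOf_isClosed (hL : L.IsRegular) : {M | IsClosed L M}.Finite := by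
  obtain ⟨σ, _, A, rfl⟩ := hL
  -- A closed set is determined by the set of state transformations its words induce, and there are
  -- finitely many such sets.
  refine Set.Finite.of_finite_image (f := fun M : Language α =>
    (fun v s => A.evalFrom s v) '' (show Set (List α) from M))
    (Set.toFinite (_ : Set (Set (σ → σ)))) fun M hM N hN h => ?_
  have key : ∀ {M N : Language α}, IsClosed A.accepts N →
      (fun v s => A.evalFrom s v) '' (show Set (List α) from M) =
        (fun v s => A.evalFrom s v) '' (show Set (List α) from N) → M ≤ N := by
    intro M N hN h v hv
    obtain ⟨w, hw, e⟩ := h.le (Set.mem_image_of_mem _ hv)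
    exact mem_of_evalFrom_eq hN (congrFun e) hw
  exact le_antisymm (key hN h) (key hM h.symm)

/-- One-sided inverses in the syntactic concept lattice of a regular language are two-sided. -/
theorem comp_eq_unit_of_comp_eq_unit (hL : L.IsRegular) (hM : IsClosed L M)
    (h : comp L M N = unit L) : comp L N M = unit L := by
  have : Finite {K | IsClosed L K} := finite_setOf_isClosed hL
  -- Multiplication by `M` undoes multiplication by `N`, so the latter is injective, hence
  -- surjective by finiteness; a preimage `K` of the unit is a right inverse of `N`, and must equal
  -- `M`.
  let f : {K | IsClosed L K} → {K | IsClosed L K} := fun K => ⟨comp L N K, isClosed_closure⟩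
  have hf : Function.LeftInverse (fun K => ⟨comp L M K, isClosed_closure⟩) f := fun K => by
    ext1
    change comp L M (comp L N K) = K
    rw [← comp_assoc, h, unit_comp K.2]
  obtain ⟨K, hK⟩ := Finite.surjective_of_injective hf.injective ⟨unit L, isClosed_closure⟩
  have hK' : comp L N K = unit L := congrArg Subtype.val hK
  have : (K : Language α) = M := by
    rw [← unit_comp K.2, ← h, comp_assoc, hK', comp_unit hM]
  rwa [this] at hK'

end Closure

/-! ### Soundness for binary relations -/

section Relational

variable {X : Type*} {c : Calculus}

/-- The interpretation of formulae by binary relations on `X`. -/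
def relInterp (ρ : ℕ → X → X → Prop) : Formula c → X → X → Prop
  | .var n => ρ n
  | .one => Eq
  | .top => fun _ _ => True
  | .bot => fun _ _ => False
  | .ldiv A B => fun y z => ∀ x, relInterp ρ A x y → relInterp ρ B x z
  | .rdiv B A => fun x y => ∀ z, relInterp ρ A y z → relInterp ρ B x z
  | .prod A B => Relation.Comp (relInterp ρ A) (relInterp ρ B)
  | .conj A B => fun x y => relInterp ρ A x y ∧ relInterp ρ B x y
  | .disj A B => fun x y => relInterp ρ A x y ∨ relInterp ρ B x y
  | .star _ A => Relation.ReflTransGen (relInterp ρ A)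

/-- The composition of the relations that interpret the formulae of a list. -/
def relInterpList (ρ : ℕ → X → X → Prop) : List (Formula c) → X → X → Prop
  | [] => Eq
  | A :: Γ => Relation.Comp (relInterp ρ A) (relInterpList ρ Γ)

variable {ρ : ℕ → X → X → Prop}

theorem relInterpList_append (Γ Δ : List (Formula c)) :
    relInterpList ρ (Γ ++ Δ) = Relation.Comp (relInterpList ρ Γ) (relInterpList ρ Δ) := by
  induction Γ with
  | nil => simp [relInterpList, Relation.eq_comp]
  | cons A Γ ih => simp only [List.cons_append, relInterpList, ih, Relation.comp_assoc]

theorem relInterpList_singleton (A : Formula c) : relInterpList ρ [A] = relInterp ρ A := by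
  simp [relInterpList, Relation.comp_eq]

/-- Each path is finite, so its length selects a single premise of the ω-rule. -/
theorem exists_relInterpList_replicate {A : Formula c} {x y : X}
    (h : Relation.ReflTransGen (relInterp ρ A) x y) :
    ∃ n, relInterpList ρ (List.replicate n A) x y := by
  induction h using Relation.ReflTransGen.head_induction_on with
  | refl => exact ⟨0, rfl⟩
  | head h _ ih =>
    obtain ⟨n, hn⟩ := ih
    exact ⟨n + 1, _, h, hn⟩

theorem reflTransGen_of_relInterpList_flatten {A : Formula c} (Ps : List (List (Formula c)))
    (h : ∀ P ∈ Ps, relInterpList ρ P ≤ relInterp ρ A) :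
    relInterpList ρ Ps.flatten ≤ Relation.ReflTransGen (relInterp ρ A) := by
  induction Ps with
  | nil => rintro x _ rfl; exact .refl
  | cons P Ps ih =>
    intro x y hxy
    rw [List.flatten_cons, relInterpList_append] at hxy
    obtain ⟨z, hz, hzy⟩ := hxy
    exact .head (h P (by simp) _ _ hz) (ih (fun Q hQ => h Q (by simp [hQ])) _ _ hzy)

/-- Soundness of the calculi for the interpretation by binary relations. -/
theorem Derives.relInterpList_le {H : Set (Sequent c)}
    (hH : ∀ t ∈ H, relInterpList ρ t.ante ≤ relInterp ρ t.succ) {Γ : List (Formula c)}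
    {C : Formula c} (h : Derives H Γ C) : relInterpList ρ Γ ≤ relInterp ρ C := by
  induction h with
  | hyp h => exact hH _ h
  | id A => exact (relInterpList_singleton A).le
  | bot_left Γ Δ C =>
    simp only [relInterpList_append, relInterpList_singleton]
    rintro x y ⟨_, ⟨_, _, h⟩, _⟩
    exact h.elim
  | top_right Γ => exact fun _ _ _ => trivial
  | one_left _ ih =>
    simpa [relInterpList_append, relInterpList, relInterp, Relation.comp_eq] using ih
  | one_right => exact le_rfl
  | prod_left _ ih =>
    simpa [relInterpList_append, relInterpList, relInterp, Relation.comp_eq,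
      Relation.comp_assoc] using ih
  | prod_right _ _ ih₁ ih₂ =>
    rw [relInterpList_append]
    rintro x y ⟨z, h₁, h₂⟩
    exact ⟨z, ih₁ _ _ h₁, ih₂ _ _ h₂⟩
  | ldiv_left _ _ ih₁ ih₂ =>
    simp only [relInterpList_append, relInterpList_singleton] at ih₂ ⊢
    rintro x y ⟨v, ⟨u, ⟨w, h₁, h₂⟩, h₃⟩, h₄⟩
    exact ih₂ _ _ ⟨v, ⟨w, h₁, h₃ w (ih₁ _ _ h₂)⟩, h₄⟩
  | ldiv_right _ ih =>
    simp only [relInterpList_append, relInterpList_singleton] at ih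
    exact fun x y h z hz => ih _ _ ⟨x, hz, h⟩
  | rdiv_left _ _ ih₁ ih₂ =>
    simp only [relInterpList_append, relInterpList_singleton] at ih₂ ⊢
    rintro x y ⟨v, ⟨u, ⟨w, h₁, h₂⟩, h₃⟩, h₄⟩
    exact ih₂ _ _ ⟨v, ⟨w, h₁, h₂ v (ih₁ _ _ h₃)⟩, h₄⟩
  | rdiv_right _ ih =>
    simp only [relInterpList_append, relInterpList_singleton] at ih
    exact fun x y h z hz => ih _ _ ⟨y, h, hz⟩
  | conj_left₁ _ ih =>
    simp only [relInterpList_append, relInterpList_singleton] at ih ⊢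
    rintro x y ⟨v, ⟨u, h₁, h₂⟩, h₃⟩
    exact ih _ _ ⟨v, ⟨u, h₁, h₂.1⟩, h₃⟩
  | conj_left₂ _ ih =>
    simp only [relInterpList_append, relInterpList_singleton] at ih ⊢
    rintro x y ⟨v, ⟨u, h₁, h₂⟩, h₃⟩
    exact ih _ _ ⟨v, ⟨u, h₁, h₂.2⟩, h₃⟩
  | conj_right _ _ ih₁ ih₂ => exact fun x y h => ⟨ih₁ _ _ h, ih₂ _ _ h⟩
  | disj_left _ _ ih₁ ih₂ =>
    simp only [relInterpList_append, relInterpList_singleton] at ih₁ ih₂ ⊢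
    rintro x y ⟨v, ⟨u, h₁, h₂ | h₂⟩, h₃⟩
    · exact ih₁ _ _ ⟨v, ⟨u, h₁, h₂⟩, h₃⟩
    · exact ih₂ _ _ ⟨v, ⟨u, h₁, h₂⟩, h₃⟩
  | disj_right₁ _ ih => exact fun x y h => Or.inl (ih _ _ h)
  | disj_right₂ _ ih => exact fun x y h => Or.inr (ih _ _ h)
  | cut _ _ ih₁ ih₂ =>
    simp only [relInterpList_append, relInterpList_singleton] at ih₂ ⊢
    rintro x y ⟨v, ⟨u, h₁, h₂⟩, h₃⟩
    exact ih₂ _ _ ⟨v, ⟨u, h₁, ih₁ _ _ h₂⟩, h₃⟩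
  | star_left _ ih =>
    simp only [relInterpList_append, relInterpList_singleton] at ih ⊢
    rintro x y ⟨v, ⟨u, h₁, h₂⟩, h₃⟩
    obtain ⟨n, hn⟩ := exists_relInterpList_replicate h₂
    exact ih n _ _ ⟨v, ⟨u, h₁, hn⟩, h₃⟩
  | star_right Ps _ ih => exact reflTransGen_of_relInterpList_flatten Ps ih

end Relational

/-! ### The counterexample -/

section Bicyclic

variable {c : Calculus}

/-- The hypotheses stating that the product of the first two variables is the unit. -/
def inverseHyps (c : Calculus) : Set (Sequent c) :=
  {⟨[], .prod (.var 0) (.var 1)⟩, ⟨[.var 0, .var 1], .one⟩}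

/-- The sequent stating that the product of the first two variables, in reversed order, is above
the unit. -/
def inverseSequent (c : Calculus) : Sequent c := ⟨[], .prod (.var 1) (.var 0)⟩

theorem entails_inverseSequent : Entails regularModels (inverseHyps c) (inverseSequent c) := by
  intro 𝔪 h𝔪 h
  have h₁ : unit 𝔪.L ≤ comp 𝔪.L (𝔪.val 0) (𝔪.val 1) := h _ (Or.inl rfl)
  have h₂ : comp 𝔪.L (𝔪.val 0) (comp 𝔪.L (𝔪.val 1) (unit 𝔪.L)) ≤ unit 𝔪.L := h _ (Or.inr rfl)
  -- The fold that interprets an antecedent ends in a trailing unit.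
  rw [comp_unit (𝔪.isClosed_val 1)] at h₂
  exact (comp_eq_unit_of_comp_eq_unit h𝔪 (𝔪.isClosed_val 0)
    (le_antisymm h₂ h₁)).ge

theorem not_derives_inverseSequent :
    ¬ Derives (inverseHyps c) (inverseSequent c).ante (inverseSequent c).succ := by
  intro h
  -- Variable 0 is the successor relation; all the others are its converse.
  let ρ : ℕ → ℕ → ℕ → Prop := fun n x y => if n = 0 then y = x + 1 else x = y + 1
  have hρ : ∀ t ∈ inverseHyps c, relInterpList ρ t.ante ≤ relInterp ρ t.succ := by
    rintro t (rfl | rfl)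
    · rintro x _ rfl
      exact ⟨x + 1, rfl, rfl⟩
    · rintro x y ⟨z, hz, w, hw, rfl⟩
      have hz : z = x + 1 := hz
      have hw : z = w + 1 := hw
      exact Nat.succ_injective (hz.symm.trans hw)
  -- The pair `(0, 0)` would have to pass through a predecessor `z` of 0.
  obtain ⟨z, hz, _⟩ := h.relInterpList_le hρ 0 0 rfl
  exact Nat.succ_ne_zero z (Eq.symm hz)

/-- Entailment persists when the class of models shrinks, so the same sequent serves every subclass.
-/
theorem not_stronglyCompleteFinite {𝔐 : Set Model.{u}} (h𝔐 : 𝔐 ⊆ regularModels) :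
    ¬ StronglyCompleteFinite c 𝔐 := fun h =>
  not_derives_inverseSequent (h _ _ ((Set.finite_singleton _).insert _) fun 𝔪 h𝔪 =>
    entails_inverseSequent 𝔪 (h𝔐 h𝔪))

theorem StronglyComplete.finite {𝔐 : Set Model.{u}} (h : StronglyComplete c 𝔐) :
    StronglyCompleteFinite c 𝔐 := fun H s _ => h H s

end Bicyclic

theorem standardRegularModels_subset : standardRegularModels ⊆ regularModels := fun _ h => h.1

end SCL

theorem mainTheorem5 :
    (¬ SCL.StronglyComplete SCL.Calculus.actω SCL.regularModels.{u} ∧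
      ¬ SCL.StronglyComplete SCL.Calculus.malc SCL.regularModels.{u}) ∧
    (¬ SCL.StronglyComplete SCL.Calculus.actω SCL.standardRegularModels.{u} ∧
      ¬ SCL.StronglyComplete SCL.Calculus.malc SCL.standardRegularModels.{u}) ∧
    (¬ SCL.StronglyCompleteFinite SCL.Calculus.actω SCL.regularModels.{u} ∧
      ¬ SCL.StronglyCompleteFinite SCL.Calculus.malc SCL.regularModels.{u}) ∧
    (¬ SCL.StronglyCompleteFinite SCL.Calculus.actω SCL.standardRegularModels.{u} ∧
      ¬ SCL.StronglyCompleteFinite SCL.Calculus.malc SCL.standardRegularModels.{u}) := by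
  have hr (c) : ¬ SCL.StronglyCompleteFinite c SCL.regularModels.{u} :=
    SCL.not_stronglyCompleteFinite subset_rfl
  have hs (c) : ¬ SCL.StronglyCompleteFinite c SCL.standardRegularModels.{u} :=
    SCL.not_stronglyCompleteFinite SCL.standardRegularModels_subset
  exact ⟨⟨fun h => hr _ h.finite, fun h => hr _ h.finite⟩,
    ⟨fun h => hs _ h.finite, fun h => hs _ h.finite⟩, ⟨hr _, hr _⟩, hs _, hs _⟩
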